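/- A continuous function $f:\mathbb{R}\to\mathbb{C}$ is called \emph{(Bochner) almost automorphic}, $f\in\mathcal{C}_{aa}$, if every real sequence $(s_m)_{m\in\mathbb{N}}$ has a subsequence $(s_{m_k})_k$ such that $g(x):=\lim_{k\to\infty}f(x+s_{m_k})$ exists for every $x\in\mathbb{R}$ and $\lim_{k\to\infty}g(x-s_{m_k})=f(x)$ for every $x\in\mathbb{R}$. Let $\mathcal{D}$ be the space of smooth compactly supported functions $\mathbb{R}\to\mathbb{C}$ and $\mathcal{D}'$ the space of distributions on $\mathbb{R}$. Let $\mathcal{D}_{L^1}$ be the space of smooth functions $\varphi:\mathbb{R}\to\mathbb{C}$ with $\varphi^{(i)}\in L^1$ for all $i\ge 0$, with the topology given by the norms $|\varphi|_{m,1}=\sum_{i=0}^m\|\varphi^{(i)}\|_{L^1}$, $m\ge 0$, and let $\mathcal{D}'_{L^\infty}\subset\mathcal{D}'$ be its topological dual (the space of bounded distributions). For $T\in\mathcal{D}'$, $h\in\mathbb{R}$ and $\varphi\in\mathcal{D}$ put $\langle\tau_hT,\varphi\rangle=\langle T,\varphi(\cdot-h)\rangle$ (so that $\tau_hf=f(\cdot+h)$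 for functions) and $(T*\varphi)(x)=\langle T,\varphi(x-\cdot)\rangle$. \textbf{Theorem.} Let $T\in\mathcal{D}'_{L^\infty}$. The following are equivalent. \begin{enumerate} \item There exist $n\ge 0$ and $f_0,\dots,f_n\in\mathcal{C}_{aa}$ such that $T=\sum_{j=0}^n f_j^{(j)}$, with derivatives in the sense of distributions. \item For every sequence $(s_m)_{m\in\mathbb{N}}\subset\mathbb{R}$ there exists a subsequence $(s_{m_k})_k$ such that $S:=\lim_{k\to\infty}\tau_{s_{m_k}}T$ exists in $\mathcal{D}'$ and $\lim_{k\to\infty}\tau_{-s_{m_k}}S=T$ in $\mathcal{D}'$. \item $T*\varphi\in\mathcal{C}_{aa}$ for every $\varphi\in\mathcal{D}$. \end{enumerate} -/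

import Mathlib

open Filter MeasureTheory TopologicalSpace
open scoped Topology ContDiff Distributions CompactConvergenceCLM

noncomputable section

namespace AlmostAutomorphic

/-! ### Almost automorphic functions -/

/-- Bochner almost automorphic functions `ℝ → ℂ`; the limit `g` is an arbitrary function. -/
def IsAlmostAutomorphic (f : ℝ → ℂ) : Prop :=
  Continuous f ∧ ∀ s : ℕ → ℝ, ∃ m : ℕ → ℕ, StrictMono m ∧ ∃ g : ℝ → ℂ,
    (∀ x, Tendsto (fun k => f (x + s (m k))) atTop (𝓝 (g x))) ∧
    ∀ x, Tendsto (fun k => g (x - s (m k))) atTop (𝓝 (f x))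

/-! ### Test functions and distributions on the line -/

/-- The space `𝓓` of smooth compactly supported functions `ℝ → ℂ`, with its LF topology. -/
abbrev TestFn : Type := 𝓓((⊤ : Opens ℝ), ℂ)

/-- The space `𝓓'` of distributions: continuous `ℂ`-linear forms on the complex-valued test
functions, with the topology of uniform convergence on compact (equivalently, bounded) subsets
of `𝓓`. -/
abbrev Distr : Type := TestFn →L_c[ℂ] ℂ

/-- A test function composed with `y ↦ y - h`. -/
def TestFn.shift (h : ℝ) (φ : TestFn) : TestFn where
  toFun y := φ (y - h)
  contDiff' := φ.contDiff.comp (contDiff_id.sub contDiff_const)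
  hasCompactSupport' := φ.hasCompactSupport.comp_homeomorph (Homeomorph.subRight h)
  tsupport_subset' := Set.subset_univ _

/-- A test function composed with `y ↦ x - y`. -/
def TestFn.reflect (x : ℝ) (φ : TestFn) : TestFn where
  toFun y := φ (x - y)
  contDiff' := φ.contDiff.comp (contDiff_const.sub contDiff_id)
  hasCompactSupport' := φ.hasCompactSupport.comp_homeomorph (Homeomorph.subLeft x)
  tsupport_subset' := Set.subset_univ _

/-- Translation `φ ↦ φ(· - h)` as a continuous linear map on test functions. -/
def TestFn.shiftCLM (h : ℝ) : TestFn →L[ℂ] TestFn :=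
  TestFunction.limitCLM ℂ (TestFn.shift h)
    (fun K _ =>
      TestFunction.ofSupportedInCLM ℂ (K := K.map (fun y => y + h) (by fun_prop))
          (Set.subset_univ _) ∘L
        ContDiffMapSupportedIn.mkCLM ℂ (fun f y => f (y - h))
          (fun _ _ _ => rfl) (fun _ _ _ => rfl)
          (fun f => f.contDiff.comp (contDiff_id.sub contDiff_const))
          (fun f y hy => f.zero_on_compl fun hK => hy ⟨y - h, hK, by simp⟩)
          (fun i _ => ⟨{i}, 1, zero_le_one, fun f x _ => by
            rw [iteratedFDeriv_comp_sub, one_mul, Finset.sup_singleton]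
            exact ContDiffMapSupportedIn.norm_iteratedFDeriv_apply_le_seminorm_top ℂ⟩))
    (fun _ _ _ => rfl)

/-- The translate `τ_h T`, which is `f(· + h)` for a function `f`: `⟨τ_h T, φ⟩ = ⟨T, φ(· - h)⟩`. -/
def Distr.translate (h : ℝ) (T : Distr) : Distr :=
  (TestFn.shiftCLM h).precompCompactConvergenceCLM ℂ T

/-- The distributional derivative, `⟨T', φ⟩ = -⟨T, φ'⟩`. -/
def Distr.deriv (T : Distr) : Distr :=
  -(TestFunction.lineDerivCLM ℂ (1 : ℝ) : TestFn →L[ℂ] TestFn).precompCompactConvergenceCLM ℂ T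

/-- The distribution `φ ↦ ∫ φ f` of a locally integrable function `f`. -/
def Distr.ofFun (f : ℝ → ℂ) : Distr :=
  ContinuousLinearMap.toUniformConvergenceCLM (RingHom.id ℂ) ℂ _
    (TestFunction.integralAgainstBilinCLM (ContinuousLinearMap.mul ℂ ℂ) volume f)

/-- The convolution `T * φ`, the function `x ↦ ⟨T, φ(x - ·)⟩`. -/
def Distr.conv (T : Distr) (φ : TestFn) : ℝ → ℂ := fun x => T (TestFn.reflect x φ)

/-! ### Bounded distributions -/

/-- The smooth functions all of whose derivatives are integrable, as a subspace of all functions. -/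
def dL1Submodule : Submodule ℂ (ℝ → ℂ) where
  carrier := {φ | ContDiff ℝ ∞ φ ∧ ∀ i : ℕ, Integrable (iteratedDeriv i φ)}
  zero_mem' := ⟨contDiff_const, fun i => by
    have h : iteratedDeriv i (0 : ℝ → ℂ) = fun _ => 0 := by
      funext x
      simp
    rw [h]
    exact integrable_zero _ _ _⟩
  add_mem' {f g} hf hg := ⟨hf.1.add hg.1, fun i => by
    have h : iteratedDeriv i (f + g) = iteratedDeriv i f + iteratedDeriv i g :=
      funext fun x => iteratedDeriv_add
        (hf.1.of_le (mod_cast le_top)).contDiffAt (hg.1.of_le (mod_cast le_top)).contDiffAt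
    rw [h]
    exact (hf.2 i).add (hg.2 i)⟩
  smul_mem' c f hf := ⟨hf.1.const_smul c, fun i => by
    have h : iteratedDeriv i (c • f) = c • iteratedDeriv i f :=
      funext fun x => iteratedDeriv_const_smul (hf.1.of_le (mod_cast le_top)).contDiffAt c
    rw [h]
    exact (hf.2 i).smul c⟩

/-- The space `𝓓_{L¹}` of smooth functions all of whose derivatives are integrable. It is a separate
type so that it does not inherit the topology of pointwise convergence. -/
def DL1 : Type := dL1Submodule

instance DL1.instAddCommGroup : AddCommGroup DL1 := inferInstanceAs (AddCommGroup dL1Submodule)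

instance DL1.instModule : Module ℂ DL1 := inferInstanceAs (Module ℂ dL1Submodule)

/-- The norms `∑_{i ≤ m} ‖φ⁽ⁱ⁾‖_{L¹}` on `𝓓_{L¹}`. -/
def DL1.seminorm : SeminormFamily ℂ DL1 ℕ := fun m =>
  Seminorm.of (fun φ => ∑ i ∈ Finset.range (m + 1), ∫ x, ‖iteratedDeriv i φ.1 x‖)
    (fun f g => by
      rw [← Finset.sum_add_distrib]
      refine Finset.sum_le_sum fun i _ => ?_
      rw [← integral_add (f.2.2 i).norm (g.2.2 i).norm]
      refine integral_mono ((f + g).2.2 i).norm ((f.2.2 i).norm.add (g.2.2 i).norm) fun x => ?_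
      have h := iteratedDeriv_add (x := x) (n := i)
        (f.2.1.of_le (mod_cast le_top)).contDiffAt (g.2.1.of_le (mod_cast le_top)).contDiffAt
      change ‖iteratedDeriv i (f.1 + g.1) x‖ ≤ _
      rw [h]
      exact norm_add_le _ _)
    (fun c f => by
      rw [Finset.mul_sum]
      refine Finset.sum_congr rfl fun i _ => ?_
      rw [← integral_const_mul]
      refine integral_congr_ae (Eventually.of_forall fun x => ?_)
      have h := iteratedDeriv_const_smul (x := x) (n := i)
        (f.2.1.of_le (mod_cast le_top)).contDiffAt c
      change ‖iteratedDeriv i (c • f.1) x‖ = _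
      rw [h, norm_smul])

/-- The Fréchet topology of `𝓓_{L¹}`, given by the norms `DL1.seminorm`. -/
instance DL1.instTopologicalSpace : TopologicalSpace DL1 :=
  DL1.seminorm.moduleFilterBasis.topology'

theorem DL1.withSeminorms : WithSeminorms DL1.seminorm := ⟨rfl⟩

/-- The inclusion `𝓓 ⊆ 𝓓_{L¹}`. -/
def TestFn.toDL1 (φ : TestFn) : DL1 :=
  ⟨φ, φ.contDiff, fun i => by
    refine Continuous.integrable_of_hasCompactSupport
      (φ.contDiff.continuous_iteratedDeriv i (mod_cast le_top)) ?_
    rw [iteratedDeriv_eq_equiv_comp]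
    exact (φ.hasCompactSupport.iteratedFDeriv i).comp_left (map_zero _)⟩

/-- Bounded distributions: `T` belongs to `𝓓'_{L^∞}`, the topological dual of `𝓓_{L¹}`, i.e. `T` is
the restriction to `𝓓` of a continuous linear form on `𝓓_{L¹}`. -/
def Distr.IsBounded (T : Distr) : Prop :=
  ∃ L : DL1 →L[ℂ] ℂ, ∀ φ : TestFn, T φ = L (TestFn.toDL1 φ)

end AlmostAutomorphic

end

open scoped Convolution

noncomputable section

namespace AlmostAutomorphic

/-! ### Almost automorphic functions: bounds, diagonal subsequences, uniform limits. -/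

namespace IsAlmostAutomorphic

variable {f : ℝ → ℂ}

/-! From sums of derivatives to translates: a diagonal argument gives one subsequence for all `f j`.
The translates are uniformly bounded, so pointwise limits pass to distributions
(`Distr.tendsto_ofFun`), and differentiation is continuous and commutes with translation. From
translates to regularizations: evaluate both limits at `reflect x φ`.

The substantial implication is from regularizations to sums of derivatives. A bounded `T` satisfies
`‖T φ‖ ≤ C * sobolev k φ` for some `k`. Fix a test function `η` of integral one and let `P` be
convolution with the compactly supported primitive of `δ - η`. Then `P φ' = φ - η ⋆ φ`, whence `T φ
= T (η ⋆ φ) + (T ∘ P) φ'`. The first term is integration against a regularization of `T`, which is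
almost automorphic (`HasOrder.integral_mul_reflect`, `HasOrder.apply_eq`). The second is, up to
sign, the derivative of `T ∘ P`, which again has almost automorphic regularizations and has order `k
- 1` when `k > 0` (`HasOrder.comp_primitive`). At order zero `T ∘ P` is itself an almost automorphic
function, a uniform limit of regularizations (`HasOrder.exists_ofFun_comp_smear`), and the induction
stops. -/

theorem zero : IsAlmostAutomorphic fun _ => 0 :=
  ⟨continuous_const, fun _ => ⟨id, strictMono_id, fun _ => 0,
    fun _ => tendsto_const_nhds, fun _ => tendsto_const_nhds⟩⟩

theorem neg (hf : IsAlmostAutomorphic f) : IsAlmostAutomorphic fun x => -f x := by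
  refine ⟨hf.1.neg, fun s => ?_⟩
  obtain ⟨m, hm, g, h₁, h₂⟩ := hf.2 s
  exact ⟨m, hm, fun x => -g x, fun x => (h₁ x).neg, fun x => (h₂ x).neg⟩

theorem bounded (hf : IsAlmostAutomorphic f) : ∃ C, ∀ x, ‖f x‖ ≤ C := by
  by_contra! h
  choose s hs using fun n : ℕ => h n
  obtain ⟨m, hm, g, h₁, -⟩ := hf.2 s
  have h₂ := (h₁ 0).norm
  refine not_tendsto_nhds_of_tendsto_atTop ?_ _ h₂
  refine tendsto_atTop_mono (fun k => ?_) tendsto_natCast_atTop_atTop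
  rw [zero_add]
  exact (Nat.cast_le.2 (hm.id_le k)).trans (hs (m k)).le

/-- A countable family of almost automorphic functions has common convergent subsequences. -/
theorem exists_common_subseq {f : ℕ → ℝ → ℂ} (hf : ∀ n, IsAlmostAutomorphic (f n)) (s : ℕ → ℝ) :
    ∃ m : ℕ → ℕ, StrictMono m ∧ ∃ g : ℕ → ℝ → ℂ, ∀ n,
      (∀ x, Tendsto (fun k => f n (x + s (m k))) atTop (𝓝 (g n x))) ∧
      ∀ x, Tendsto (fun k => g n (x - s (m k))) atTop (𝓝 (f n x)) := by
  have step : ∀ (n : ℕ) (m : {m : ℕ → ℕ // StrictMono m}), ∃ m' : {m : ℕ → ℕ // StrictMono m},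
      map m'.1 atTop ≤ map m.1 atTop ∧ ∃ g : ℝ → ℂ,
      (∀ x, Tendsto (fun j => f n (x + s j)) (map m'.1 atTop) (𝓝 (g x))) ∧
      ∀ x, Tendsto (fun j => g (x - s j)) (map m'.1 atTop) (𝓝 (f n x)) := by
    intro n m
    obtain ⟨k, hk, g, h₁, h₂⟩ := (hf n).2 (s ∘ m.1)
    refine ⟨⟨m.1 ∘ k, m.2.comp hk⟩, ?_, g, fun x => tendsto_map'_iff.2 (h₁ x),
      fun x => tendsto_map'_iff.2 (h₂ x)⟩
    rw [← Filter.map_map]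
    exact map_mono hk.tendsto_atTop
  choose next hle g₀ h₁ h₂ using step
  let M : ℕ → {m : ℕ → ℕ // StrictMono m} := Nat.rec ⟨id, strictMono_id⟩ next
  have hM : Antitone fun n => map (M n).1 atTop := antitone_nat_of_succ_le fun n => hle n (M n)
  -- Diagonal extraction by filters: the nested subsequences give a decreasing sequence of filters,
  -- and a sequence tending to their infimum is adapted to all of them at once. It need not
  -- increase, so a strictly increasing subsequence is taken afterwards.
  have : NeBot (⨅ n, map (M n).1 atTop) :=
    iInf_neBot_of_directed hM.directed_ge fun n => inferInstance
  obtain ⟨u, hu⟩ := exists_seq_tendsto (⨅ n, map (M n).1 atTop)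
  have hu' : Tendsto u atTop atTop := by
    refine hu.mono_right ((iInf_le _ 0).trans ?_)
    exact (strictMono_id : StrictMono (id : ℕ → ℕ)).tendsto_atTop
  obtain ⟨k, hk, hk'⟩ := strictMono_subseq_of_tendsto_atTop hu'
  have hl : ∀ n, Tendsto (u ∘ k) atTop (map (M (n + 1)).1 atTop) := fun n =>
    (hu.comp hk.tendsto_atTop).mono_right (iInf_le _ (n + 1))
  exact ⟨u ∘ k, hk', fun n => g₀ n (M n), fun n =>
    ⟨fun x => (h₁ n (M n) x).comp (hl n), fun x => (h₂ n (M n) x).comp (hl n)⟩⟩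

/-- An `ε / 3` argument along a subsequence common to all `F n`. The uniform bound on `f - F n`
survives translation and limits, so it also bounds `G - g n`; this handles the return limit. -/
theorem of_tendstoUniformly {F : ℕ → ℝ → ℂ} (hF : ∀ n, IsAlmostAutomorphic (F n))
    (h : TendstoUniformly F f atTop) : IsAlmostAutomorphic f := by
  refine ⟨h.continuous (.of_forall fun n => (hF n).1), fun s => ?_⟩
  obtain ⟨m, hm, g, hg⟩ := exists_common_subseq hF s
  rw [Metric.tendstoUniformly_iff] at h
  have hc : ∀ x, ∃ y, Tendsto (fun k => f (x + s (m k))) atTop (𝓝 y) := by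
    intro x
    refine cauchySeq_tendsto_of_complete (Metric.cauchySeq_iff'.2 fun ε hε => ?_)
    obtain ⟨n, hn⟩ := (h (ε / 3) (by positivity)).exists
    obtain ⟨N, hN⟩ := Metric.cauchySeq_iff'.1 ((hg n).1 x).cauchySeq (ε / 3) (by positivity)
    refine ⟨N, fun k hk => ?_⟩
    have h₁ := hn (x + s (m k))
    have h₂ := hn (x + s (m N))
    have h₃ := hN k hk
    have h₄ := dist_triangle4 (f (x + s (m k))) (F n (x + s (m k))) (F n (x + s (m N)))
      (f (x + s (m N)))
    rw [dist_comm (F n _) (f (x + s (m N)))] at h₄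
    linarith
  choose G hG using hc
  refine ⟨m, hm, G, hG, fun x => Metric.tendsto_atTop.2 fun ε hε => ?_⟩
  obtain ⟨n, hn⟩ := (h (ε / 3) (by positivity)).exists
  have hGg : ∀ y, dist (G y) (g n y) ≤ ε / 3 := fun y =>
    le_of_tendsto ((hG y).dist ((hg n).1 y)) (.of_forall fun k => (hn _).le)
  obtain ⟨N, hN⟩ := Metric.tendsto_atTop.1 ((hg n).2 x) (ε / 3) (by positivity)
  refine ⟨N, fun k hk => ?_⟩
  have h₁ := hGg (x - s (m k))
  have h₂ := hn x
  have h₃ := hN k hk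
  have h₄ := dist_triangle4 (G (x - s (m k))) (g n (x - s (m k))) (F n x) (f x)
  rw [dist_comm (F n x) (f x)] at h₄
  linarith

end IsAlmostAutomorphic

/-! ### Derivatives of test functions. -/

namespace TestFn

/-- The derivative, as a continuous linear map on test functions. -/
def derivCLM : TestFn →L[ℂ] TestFn := TestFunction.lineDerivCLM ℂ (1 : ℝ)

theorem derivCLM_apply (φ : TestFn) (x : ℝ) : derivCLM φ x = deriv φ x := by
  rw [derivCLM, TestFunction.lineDerivCLM_eq_fderivCLM, TestFunction.fderivCLM_apply_of_le _ (by simp),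
    fderiv_apply_one_eq_deriv]

theorem hasDerivAt (φ : TestFn) (x : ℝ) : HasDerivAt φ (derivCLM φ x) x := by
  rw [derivCLM_apply]
  exact (φ.contDiff.differentiable (by simp)).differentiableAt.hasDerivAt

theorem derivCLM_eq_of_hasDerivAt {φ ψ : TestFn} (h : ∀ x, HasDerivAt φ (ψ x) x) :
    derivCLM φ = ψ :=
  TestFunction.ext fun x => (φ.hasDerivAt x).unique (h x)

theorem iteratedDeriv_eq (φ : TestFn) (i : ℕ) : iteratedDeriv i φ = (derivCLM ^ i) φ := by
  induction i generalizing φ with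
  | zero => simp
  | succ i ih =>
    rw [iteratedDeriv_succ', pow_succ, mul_apply_eq_comp, ← ih]
    exact congrArg _ (funext fun x => (derivCLM_apply φ x).symm)

theorem integrable (φ : TestFn) : Integrable φ :=
  φ.continuous.integrable_of_hasCompactSupport φ.hasCompactSupport

/-! ### Reflections and translations -/

@[simp]
theorem reflect_apply (x : ℝ) (φ : TestFn) (y : ℝ) : reflect x φ y = φ (x - y) := rfl

@[simp]
theorem shiftCLM_apply (h : ℝ) (φ : TestFn) (y : ℝ) : shiftCLM h φ y = φ (y - h) := rfl

theorem reflect_sub (x : ℝ) (φ ψ : TestFn) : reflect x (φ - ψ) = reflect x φ - reflect x ψ := rfl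

theorem shiftCLM_reflect (h x : ℝ) (φ : TestFn) : shiftCLM h (reflect x φ) = reflect (x + h) φ := by
  ext y
  simp only [shiftCLM_apply, reflect_apply]
  congr 1
  ring

theorem derivCLM_reflect (x : ℝ) (φ : TestFn) :
    derivCLM (reflect x φ) = (-1 : ℂ) • reflect x (derivCLM φ) := by
  refine derivCLM_eq_of_hasDerivAt fun y => ?_
  have h := (φ.hasDerivAt (x - y)).scomp y ((hasDerivAt_id y).const_sub x)
  exact (h : HasDerivAt (reflect x φ) _ y).congr_deriv (by simp)

theorem derivCLM_pow_reflect (x : ℝ) (φ : TestFn) (i : ℕ) :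
    (derivCLM ^ i) (reflect x φ) = (-1 : ℂ) ^ i • reflect x ((derivCLM ^ i) φ) := by
  induction i generalizing φ with
  | zero => simp
  | succ i ih =>
    rw [pow_succ, mul_apply_eq_comp, derivCLM_reflect, map_smul, ih, smul_smul,
      pow_succ' (-1 : ℂ), mul_apply_eq_comp]

theorem derivCLM_shiftCLM (h : ℝ) (φ : TestFn) :
    derivCLM (shiftCLM h φ) = shiftCLM h (derivCLM φ) := by
  refine derivCLM_eq_of_hasDerivAt fun y => ?_
  have hd := (φ.hasDerivAt (y - h)).scomp y ((hasDerivAt_id y).sub_const h)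
  exact (hd : HasDerivAt (shiftCLM h φ) _ y).congr_deriv (by simp)

/-! ### Sobolev norms -/

/-- The norm `∑_{i ≤ k} ‖φ⁽ⁱ⁾‖_{L¹}`. -/
def sobolev (k : ℕ) (φ : TestFn) : ℝ :=
  ∑ i ∈ Finset.range (k + 1), ∫ x, ‖(derivCLM ^ i) φ x‖

theorem sobolev_zero (φ : TestFn) : sobolev 0 φ = ∫ x, ‖φ x‖ := by simp [sobolev]

theorem sobolev_succ (k : ℕ) (φ : TestFn) :
    sobolev (k + 1) φ = sobolev k (derivCLM φ) + ∫ x, ‖φ x‖ := by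
  rw [sobolev, Finset.sum_range_succ']
  simp [sobolev, pow_succ]

theorem sobolev_nonneg (k : ℕ) (φ : TestFn) : 0 ≤ sobolev k φ :=
  Finset.sum_nonneg fun _ _ => integral_nonneg fun _ => norm_nonneg _

theorem sobolev_mono {k l : ℕ} (h : k ≤ l) (φ : TestFn) : sobolev k φ ≤ sobolev l φ :=
  Finset.sum_le_sum_of_subset_of_nonneg (by simpa using h)
    fun _ _ _ => integral_nonneg fun _ => norm_nonneg _

/-- The test functions supported in `[-R, R]`. -/
def supportedIn (R : ℝ) : Submodule ℂ TestFn where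
  carrier := {φ | ∀ y ∉ Set.Icc (-R) R, φ y = 0}
  zero_mem' _ _ := rfl
  add_mem' hf hg y hy := by
    change _ + _ = (0 : ℂ)
    rw [hf y hy, hg y hy, add_zero]
  smul_mem' c f hf y hy := by
    change c • _ = (0 : ℂ)
    rw [hf y hy, smul_zero]

theorem exists_mem_supportedIn (φ : TestFn) : ∃ R, 0 ≤ R ∧ φ ∈ supportedIn R := by
  obtain ⟨R, hR⟩ := φ.hasCompactSupport.isCompact.isBounded.subset_closedBall 0
  refine ⟨max R 0, le_max_right _ _, fun y hy => ?_⟩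
  by_contra h
  have hy' := hR (subset_tsupport _ h)
  rw [Real.closedBall_eq_Icc, zero_sub, zero_add] at hy'
  exact hy ⟨(neg_le_neg (le_max_left _ _)).trans hy'.1, hy'.2.trans (le_max_left _ _)⟩

theorem supportedIn_mono {R R' : ℝ} (h : R ≤ R') : supportedIn R ≤ supportedIn R' :=
  fun _ hφ y hy => hφ y fun hy' => hy ⟨(neg_le_neg h).trans hy'.1, hy'.2.trans h⟩

theorem derivCLM_mem_supportedIn {R : ℝ} {φ : TestFn} (h : φ ∈ supportedIn R) :
    derivCLM φ ∈ supportedIn R := by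
  intro y hy
  rw [derivCLM_apply]
  by_contra hd
  have hs : Function.support φ ⊆ Set.Icc (-R) R := fun z hz => by
    by_contra hz'
    exact hz (h z hz')
  exact hy (closure_minimal hs isClosed_Icc (support_deriv_subset hd))

theorem derivCLM_pow_mem_supportedIn {R : ℝ} {φ : TestFn} (h : φ ∈ supportedIn R) (i : ℕ) :
    (derivCLM ^ i) φ ∈ supportedIn R := by
  induction i with
  | zero => exact h
  | succ i ih =>
    rw [pow_succ']
    exact derivCLM_mem_supportedIn ih

theorem reflect_mem_supportedIn {R x R' : ℝ} {φ : TestFn} (h : φ ∈ supportedIn R)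
    (hx : |x| ≤ R') : reflect x φ ∈ supportedIn (R + R') := by
  intro y hy
  refine h _ fun hy' => hy ?_
  have := abs_le.1 hx
  constructor <;> linarith [hy'.1, hy'.2]

/-- Test functions as bounded continuous functions. -/
abbrev toBCF : TestFn →L[ℂ] BoundedContinuousFunction ℝ ℂ :=
  TestFunction.toBoundedContinuousFunctionCLM ℂ

theorem toBCF_apply (φ : TestFn) (x : ℝ) : toBCF φ x = φ x := rfl

theorem integral_norm_le {R : ℝ} (hR : 0 ≤ R) {φ : TestFn} (h : φ ∈ supportedIn R) :
    ∫ x, ‖φ x‖ ≤ 2 * R * ‖toBCF φ‖ := by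
  rw [← setIntegral_eq_integral_of_forall_compl_eq_zero (s := Set.Icc (-R) R)
    fun x hx => by rw [h x hx, norm_zero]]
  have := norm_setIntegral_le_of_norm_le_const (μ := volume) (s := Set.Icc (-R) R)
    (f := fun x => ‖φ x‖) (C := ‖toBCF φ‖) (by simp)
    fun x _ => by
      rw [norm_norm]
      exact (toBCF φ).norm_coe_le_norm x
  refine (le_abs_self _).trans (this.trans (le_of_eq ?_))
  rw [Measure.real, Real.volume_Icc, ENNReal.toReal_ofReal (by linarith)]
  ring

/-- The derivatives up to order `k`, as bounded continuous functions. -/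
def jet (k : ℕ) : TestFn →L[ℂ] (Fin (k + 1) → BoundedContinuousFunction ℝ ℂ) :=
  ContinuousLinearMap.pi fun i => toBCF ∘L derivCLM ^ (i : ℕ)

theorem jet_apply (k : ℕ) (φ : TestFn) (i : Fin (k + 1)) :
    jet k φ i = toBCF ((derivCLM ^ (i : ℕ)) φ) := rfl

/-- On a fixed compact set sup norms control `L¹` norms. This moves estimates into a Banach space of
jets, where `x ↦ reflect x φ` is continuous and can be integrated. -/
theorem sobolev_le {R : ℝ} (hR : 0 ≤ R) (k : ℕ) {φ : TestFn} (h : φ ∈ supportedIn R) :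
    sobolev k φ ≤ (k + 1) * (2 * R) * ‖jet k φ‖ := by
  have hi : ∀ i ∈ Finset.range (k + 1), ∫ x, ‖(derivCLM ^ i) φ x‖ ≤ 2 * R * ‖jet k φ‖ := by
    intro i hi
    refine (integral_norm_le hR (derivCLM_pow_mem_supportedIn h i)).trans ?_
    gcongr
    exact norm_le_pi_norm (jet k φ) ⟨i, Finset.mem_range.1 hi⟩
  refine (Finset.sum_le_sum hi).trans (le_of_eq ?_)
  simp
  ring

theorem continuous_toBCF_reflect (φ : TestFn) : Continuous fun x => toBCF (reflect x φ) := by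
  have hu := φ.hasCompactSupport.uniformContinuous_of_continuous φ.continuous
  rw [Metric.uniformContinuous_iff] at hu
  refine Metric.continuous_iff.2 fun x ε hε => ?_
  obtain ⟨δ, hδ, h⟩ := hu (ε / 2) (by positivity)
  refine ⟨δ, hδ, fun z hz => lt_of_le_of_lt ?_ (half_lt_self hε)⟩
  refine (BoundedContinuousFunction.dist_le (by positivity)).2 fun y => (h ?_).le
  rwa [dist_sub_right]

theorem continuous_jet_reflect (k : ℕ) (φ : TestFn) : Continuous fun x => jet k (reflect x φ) := by
  refine continuous_pi fun i => ?_
  simp_rw [jet_apply, derivCLM_pow_reflect, map_smul]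
  exact (continuous_toBCF_reflect ((derivCLM ^ (i : ℕ)) φ)).const_smul ((-1 : ℂ) ^ (i : ℕ))

/-! ### Convolution of test functions with integrable functions of compact support -/

/-- The convolution `u ⋆ φ` of an integrable compactly supported function and a test function. -/
def smear (u : ℝ → ℂ) (hu : Integrable u) (hc : HasCompactSupport u) : TestFn →ₗ[ℂ] TestFn where
  toFun φ :=
    { toFun := u ⋆[ContinuousLinearMap.mul ℝ ℂ] φ
      contDiff' := φ.hasCompactSupport.contDiff_convolution_right _ hu.locallyIntegrable φ.contDiff
      hasCompactSupport' := hc.convolution _ φ.hasCompactSupport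
      tsupport_subset' := Set.subset_univ _ }
  map_add' φ ψ := TestFunction.ext fun x =>
    (φ.hasCompactSupport.convolutionExists_right _ hu.locallyIntegrable φ.continuous x).distrib_add
      (ψ.hasCompactSupport.convolutionExists_right _ hu.locallyIntegrable ψ.continuous x)
  map_smul' c φ := TestFunction.ext fun x => by
    change ∫ t, u t * (c * φ (x - t)) = c * ∫ t, u t * φ (x - t)
    rw [← integral_const_mul]
    exact integral_congr_ae (.of_forall fun t => by ring)

variable {u : ℝ → ℂ} {hu : Integrable u} {hc : HasCompactSupport u}

theorem smear_apply (φ : TestFn) (x : ℝ) : smear u hu hc φ x = ∫ t, u t * φ (x - t) := rfl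

theorem derivCLM_smear (φ : TestFn) :
    derivCLM (smear u hu hc φ) = smear u hu hc (derivCLM φ) := by
  refine derivCLM_eq_of_hasDerivAt fun x => ?_
  have h := φ.hasCompactSupport.hasDerivAt_convolution_right (ContinuousLinearMap.mul ℝ ℂ)
    hu.locallyIntegrable (φ.contDiff.of_le (by simp)) x
  have hd : deriv φ = derivCLM φ := funext fun y => (derivCLM_apply φ y).symm
  rw [hd] at h
  exact h

theorem derivCLM_pow_smear (φ : TestFn) (i : ℕ) :
    (derivCLM ^ i) (smear u hu hc φ) = smear u hu hc ((derivCLM ^ i) φ) := by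
  induction i generalizing φ with
  | zero => simp
  | succ i ih => rw [pow_succ, mul_apply_eq_comp, derivCLM_smear, ih, mul_apply_eq_comp]

theorem hasCompactSupport_comp_neg (hc : HasCompactSupport u) :
    HasCompactSupport fun t => u (-t) :=
  hc.comp_homeomorph (Homeomorph.neg ℝ)

/-- Regularizing `U ∘ smear u` by `φ` is regularizing `U` by another test function, so almost
automorphy of regularizations is inherited. -/
theorem smear_reflect (x : ℝ) (φ : TestFn) :
    smear u hu hc (reflect x φ) =
      reflect x (smear (fun t => u (-t)) hu.comp_neg
        (hasCompactSupport_comp_neg hc) φ) := by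
  ext y
  rw [smear_apply, reflect_apply, smear_apply, ← integral_neg_eq_self]
  refine integral_congr_ae (.of_forall fun t => ?_)
  simp only [reflect_apply]
  congr 2
  ring

/-- Young's inequality in `L¹`: the convolution of the norms dominates, and its integral factors. -/
theorem integral_norm_smear_le (φ : TestFn) :
    ∫ x, ‖smear u hu hc φ x‖ ≤ (∫ x, ‖u x‖) * ∫ x, ‖φ x‖ := by
  have h := integral_convolution (ContinuousLinearMap.mul ℝ ℝ) hu.norm φ.integrable.norm
  simp only [ContinuousLinearMap.mul_apply'] at h
  rw [← h]
  refine integral_mono (integrable _).norm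
    (hu.norm.integrable_convolution (ContinuousLinearMap.mul ℝ ℝ) φ.integrable.norm) fun x => ?_
  rw [smear_apply]
  refine (norm_integral_le_integral_norm _).trans (le_of_eq ?_)
  simp [convolution_def]

theorem sobolev_smear_le (k : ℕ) (φ : TestFn) :
    sobolev k (smear u hu hc φ) ≤ (∫ x, ‖u x‖) * sobolev k φ := by
  rw [sobolev, sobolev, Finset.mul_sum]
  refine Finset.sum_le_sum fun i _ => ?_
  rw [derivCLM_pow_smear]
  exact integral_norm_smear_le _

theorem smear_comm (φ ψ : TestFn) :
    smear φ φ.integrable φ.hasCompactSupport ψ = smear ψ ψ.integrable ψ.hasCompactSupport φ := by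
  ext x
  rw [smear_apply, smear_apply, ← integral_sub_left_eq_self _ volume x]
  refine integral_congr_ae (.of_forall fun t => ?_)
  simp [mul_comm]

/-! ### Inverting the derivative up to a smoothing operator -/

/-- The compactly supported primitive of `δ - η`, for a test function `η` of integral one. -/
def primitiveKernel (η : TestFn) (x : ℝ) : ℂ :=
  (Set.Ioi 0).indicator 1 x - ∫ t in Set.Iic x, η t

section

variable (η : TestFn)

theorem hasDerivAt_integral_Iic (x : ℝ) :
    HasDerivAt (fun x => ∫ t in Set.Iic x, η t) (η x) x := by
  have h : ∀ y, ∫ t in Set.Iic y, η t = (∫ t in Set.Iic x, η t) + ∫ t in x..y, η t := fun y => by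
    rw [← intervalIntegral.integral_Iic_sub_Iic η.integrable.integrableOn
      η.integrable.integrableOn]
    ring
  rw [funext h]
  exact (intervalIntegral.integral_hasDerivAt_right (η.continuous.intervalIntegrable _ _)
    (η.continuous.stronglyMeasurableAtFilter _ _) η.continuous.continuousAt).const_add _

theorem continuous_integral_Iic : Continuous fun x => ∫ t in Set.Iic x, η t :=
  continuous_iff_continuousAt.2 fun x => (hasDerivAt_integral_Iic η x).continuousAt

theorem norm_integral_Iic_le (x : ℝ) : ‖∫ t in Set.Iic x, η t‖ ≤ ∫ t, ‖η t‖ :=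
  (norm_integral_le_integral_norm _).trans
    (setIntegral_le_integral η.integrable.norm (.of_forall fun _ => norm_nonneg _))

theorem norm_primitiveKernel_le (x : ℝ) : ‖primitiveKernel η x‖ ≤ 1 + ∫ t, ‖η t‖ := by
  refine (norm_sub_le _ _).trans (add_le_add ?_ (norm_integral_Iic_le η x))
  refine (norm_indicator_le_norm_self _ _).trans ?_
  simp

theorem measurable_primitiveKernel : Measurable (primitiveKernel η) :=
  (measurable_one.indicator measurableSet_Ioi).sub
    (continuous_integral_Iic η).measurable

variable {η}

/-- Left of the support of `η` (and of `0`) both terms vanish; to the right they are `1` and `∫ η =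
1`, and cancel. -/
theorem hasCompactSupport_primitiveKernel (hη : ∫ t, η t = 1) :
    HasCompactSupport (primitiveKernel η) := by
  obtain ⟨R, hR, h⟩ := η.exists_mem_supportedIn
  refine HasCompactSupport.intro (isCompact_Icc (a := -R) (b := R)) fun x hx => ?_
  rw [primitiveKernel]
  rcases lt_or_ge x (-R) with hx' | hx'
  · rw [Set.indicator_of_notMem (by simp; linarith), zero_sub, neg_eq_zero]
    exact setIntegral_eq_zero_of_forall_eq_zero fun t ht =>
      h t fun ht' => by linarith [ht'.1, Set.mem_Iic.1 ht]
  · have hx'' : R < x := not_le.1 fun h' => hx ⟨hx', h'⟩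
    rw [Set.indicator_of_mem (by simp; linarith),
      setIntegral_eq_integral_of_forall_compl_eq_zero (s := Set.Iic x) fun t ht => h t fun ht' => ht (ht'.2.trans hx''.le), hη]
    simp

theorem integrable_of_bounded {u : ℝ → ℂ} (hm : AEStronglyMeasurable u) (hc : HasCompactSupport u)
    {C : ℝ} (hC : ∀ x, ‖u x‖ ≤ C) : Integrable u := by
  rw [← integrableOn_iff_integrable_of_support_subset (subset_tsupport u)]
  exact IntegrableOn.of_bound hc.isCompact.measure_lt_top hm.restrict C (.of_forall hC)

theorem integrable_primitiveKernel (hη : ∫ t, η t = 1) : Integrable (primitiveKernel η) :=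
  integrable_of_bounded (measurable_primitiveKernel η).aestronglyMeasurable
    (hasCompactSupport_primitiveKernel hη) (norm_primitiveKernel_le η)

/-- Convolution with the primitive kernel of `η`. -/
def primitive (hη : ∫ t, η t = 1) : TestFn →ₗ[ℂ] TestFn :=
  smear (primitiveKernel η) (integrable_primitiveKernel hη) (hasCompactSupport_primitiveKernel hη)

/-- The derivative moves onto the kernel, giving `(δ - η) ⋆ φ`: the step function yields `φ x` by
the fundamental theorem of calculus, the smooth part yields `η ⋆ φ` by parts. -/
theorem primitive_derivCLM (hη : ∫ t, η t = 1) (φ : TestFn) :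
    primitive hη (derivCLM φ) = φ - smear η η.integrable η.hasCompactSupport φ := by
  ext x
  change primitive hη (derivCLM φ) x = φ x - smear η η.integrable η.hasCompactSupport φ x
  rw [primitive, smear_apply, smear_apply]
  have hcont := (continuous_integral_Iic η)
  have hψ : ∀ t, HasDerivAt (fun t => φ (x - t)) (-derivCLM φ (x - t)) t := fun t => by
    have h := (reflect x φ).hasDerivAt t
    rw [derivCLM_reflect] at h
    exact h.congr_deriv (by simp)
  have hi : Integrable fun t => derivCLM φ (x - t) := (reflect x (derivCLM φ)).integrable
  have hparts : ∫ t, (∫ s in Set.Iic t, η s) * -derivCLM φ (x - t) = -∫ t, η t * φ (x - t) := by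
    refine integral_mul_deriv_eq_deriv_mul_of_integrable
      (fun t _ => hasDerivAt_integral_Iic η t) (fun t _ => hψ t) ?_ ?_ ?_
    · exact hi.neg.bdd_mul hcont.aestronglyMeasurable (.of_forall (norm_integral_Iic_le η))
    · exact (reflect x φ).integrable.bdd_mul η.continuous.aestronglyMeasurable
        (.of_forall (toBCF η).norm_coe_le_norm)
    · exact (reflect x φ).integrable.bdd_mul hcont.aestronglyMeasurable
        (.of_forall (norm_integral_Iic_le η))
  have hbdry : ∫ t in Set.Ioi 0, derivCLM φ (x - t) = φ x := by
    have h := HasCompactSupport.integral_Ioi_deriv_eq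
      ((reflect x φ).contDiff.of_le (by simp)) (reflect x φ).hasCompactSupport 0
    simp only [← derivCLM_apply, derivCLM_reflect] at h
    simpa [integral_neg] using h
  simp only [primitiveKernel, sub_mul]
  rw [integral_sub]
  · congr 1
    · rw [← hbdry, ← integral_indicator measurableSet_Ioi]
      refine integral_congr_ae (.of_forall fun t => ?_)
      by_cases ht : t ∈ Set.Ioi (0 : ℝ) <;> simp [ht]
    · simpa [integral_neg] using hparts
  · exact hi.bdd_mul (measurable_one.indicator measurableSet_Ioi).aestronglyMeasurable (c := 1)
      (.of_forall fun t => (norm_indicator_le_norm_self _ _).trans (by simp))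
  · exact hi.bdd_mul hcont.aestronglyMeasurable (.of_forall (norm_integral_Iic_le η))

end

theorem sobolev_sub_le (k : ℕ) (φ ψ : TestFn) : sobolev k (φ - ψ) ≤ sobolev k φ + sobolev k ψ := by
  rw [sobolev, sobolev, sobolev, ← Finset.sum_add_distrib]
  refine Finset.sum_le_sum fun i _ => ?_
  rw [map_sub, ← integral_add (integrable _).norm (integrable _).norm]
  exact integral_mono (integrable _).norm ((integrable _).norm.add (integrable _).norm)
    fun x => norm_sub_le _ _

theorem integral_norm_reflect (x : ℝ) (φ : TestFn) : ∫ y, ‖reflect x φ y‖ = ∫ y, ‖φ y‖ :=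
  integral_sub_left_eq_self (fun y => ‖φ y‖) volume x

/-! ### Linear forms that are bounded for a Sobolev norm -/

/-- The linear form `U` is bounded by a multiple of the norm `sobolev k`. -/
def HasOrder (U : TestFn →ₗ[ℂ] ℂ) (k : ℕ) : Prop :=
  ∃ C, 0 ≤ C ∧ ∀ φ, ‖U φ‖ ≤ C * sobolev k φ

variable {U : TestFn →ₗ[ℂ] ℂ} {k : ℕ}

theorem HasOrder.exists_jet_bound (hU : HasOrder U k) {R : ℝ} (hR : 0 ≤ R) :
    ∃ C, 0 ≤ C ∧ ∀ φ ∈ supportedIn R, ‖U φ‖ ≤ C * ‖jet k φ‖ := by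
  obtain ⟨C, hC, h⟩ := hU
  refine ⟨C * ((k + 1) * (2 * R)), by positivity, fun φ hφ => (h φ).trans ?_⟩
  rw [mul_assoc]
  exact mul_le_mul_of_nonneg_left (sobolev_le hR k hφ) hC

theorem HasOrder.continuous_reflect (hU : HasOrder U k) (φ : TestFn) :
    Continuous fun x => U (reflect x φ) := by
  refine continuous_iff_continuousAt.2 fun x => ?_
  obtain ⟨R, hR, hφ⟩ := φ.exists_mem_supportedIn
  obtain ⟨C, hC, h⟩ := hU.exists_jet_bound (R := R + (|x| + 1)) (by positivity)
  refine tendsto_iff_norm_sub_tendsto_zero.2 ?_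
  have hj : Tendsto (fun y => C * ‖jet k (reflect y φ) - jet k (reflect x φ)‖) (𝓝 x) (𝓝 0) := by
    have := (tendsto_iff_norm_sub_tendsto_zero.1
      ((continuous_jet_reflect k φ).tendsto x)).const_mul C
    rwa [mul_zero] at this
  refine squeeze_zero' (.of_forall fun _ => norm_nonneg _) ?_ hj
  have hx : ∀ᶠ y in 𝓝 x, |y| < |x| + 1 :=
    (continuous_abs.tendsto x).eventually_lt_const (lt_add_one _)
  filter_upwards [hx] with y hy
  rw [← map_sub, ← map_sub]
  exact h _ (Submodule.sub_mem _ (reflect_mem_supportedIn hφ hy.le)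
    (reflect_mem_supportedIn hφ (by linarith)))

/-- A linear form of finite order commutes with the integral defining a convolution. -/
theorem HasOrder.integral_mul_reflect (hU : HasOrder U k) (ρ χ : TestFn) :
    ∫ x, χ x * U (reflect x ρ) =
      U (smear χ χ.integrable χ.hasCompactSupport (reflect 0 ρ)) := by
  obtain ⟨R₁, hR₁, hρ⟩ := ρ.exists_mem_supportedIn
  obtain ⟨R₂, hR₂, hχ⟩ := χ.exists_mem_supportedIn
  set w := smear χ χ.integrable χ.hasCompactSupport (reflect 0 ρ)
  obtain ⟨R₃, hR₃, hw⟩ := w.exists_mem_supportedIn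
  set R := max (R₁ + R₂) R₃
  have hw' : w ∈ supportedIn R := supportedIn_mono (le_max_right _ _) hw
  obtain ⟨C, hC, hb⟩ := hU.exists_jet_bound (R := R) (hR₃.trans (le_max_right _ _))
  -- The integral is taken in the closure `P` of the graph of `U` over jets, because the jets of
  -- test functions do not form a complete space. The bound on `U` extends to `P`, so a point of `P`
  -- with first component `jet k w` has second component `U w`.
  let G : TestFn →ₗ[ℂ] (Fin (k + 1) → BoundedContinuousFunction ℝ ℂ) × ℂ :=
    (jet k).toLinearMap.prod U
  let P := ((supportedIn R).map G).topologicalClosure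
  have hP : ∀ q ∈ P, ‖q.2 - U w‖ ≤ C * ‖q.1 - jet k w‖ := by
    have hcl : IsClosed {q : (Fin (k + 1) → BoundedContinuousFunction ℝ ℂ) × ℂ |
        ‖q.2 - U w‖ ≤ C * ‖q.1 - jet k w‖} :=
      isClosed_le (by fun_prop) (by fun_prop)
    refine fun q hq => closure_minimal ?_ hcl hq
    rintro _ ⟨φ, hφ, rfl⟩
    change ‖U φ - U w‖ ≤ C * ‖jet k φ - jet k w‖
    rw [← map_sub, ← map_sub]
    exact hb _ (Submodule.sub_mem _ hφ hw')
  let c : ℝ → (Fin (k + 1) → BoundedContinuousFunction ℝ ℂ) × ℂ :=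
    fun x => χ x • G (reflect x ρ)
  have hc : Continuous c :=
    χ.continuous.smul ((continuous_jet_reflect k ρ).prodMk (hU.continuous_reflect ρ))
  have hcP : ∀ x, c x ∈ P := by
    intro x
    by_cases hx : x ∈ Set.Icc (-R₂) R₂
    · refine Submodule.smul_mem _ _ (Submodule.le_topologicalClosure _ ⟨_, ?_, rfl⟩)
      exact supportedIn_mono (le_max_left _ _) (reflect_mem_supportedIn hρ (abs_le.2 hx))
    · simp only [c, hχ x hx, zero_smul]
      exact P.zero_mem
  have hcs : HasCompactSupport c := χ.hasCompactSupport.smul_right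
  -- Integrating inside the complete space `P` shows that the integral of `c` stays in `P`.
  let c' : ℝ → P := fun x => ⟨c x, hcP x⟩
  have hc' : Continuous c' := hc.subtype_mk _
  have hcs' : HasCompactSupport c' :=
    HasCompactSupport.intro hcs.isCompact fun x hx =>
      Subtype.ext (image_eq_zero_of_notMem_tsupport (f := c) hx)
  have hci : Integrable c := hc.integrable_of_hasCompactSupport hcs
  have : CompleteSpace P := (Submodule.isClosed_topologicalClosure _).completeSpace_coe
  have hint : ∫ x, c x ∈ P := by
    have h := P.subtypeL.integral_comp_comm (μ := volume) (hc'.integrable_of_hasCompactSupport hcs')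
    have h' : ∫ x, c x = P.subtypeL (∫ x, c' x) := h
    rw [h']
    exact Subtype.property _
  have h₁ : (∫ x, c x).1 = jet k w := by
    funext i
    ext y
    let L : (Fin (k + 1) → BoundedContinuousFunction ℝ ℂ) × ℂ →L[ℂ] ℂ :=
      BoundedContinuousFunction.evalCLM ℂ y ∘L ContinuousLinearMap.proj i ∘L
        ContinuousLinearMap.fst ℂ _ _
    have h := L.integral_comp_comm hci
    have h' : (∫ x, c x).1 i y = ∫ x, χ x * (derivCLM ^ (i : ℕ)) (reflect x ρ) y := h.symm
    rw [h', jet_apply, toBCF_apply, derivCLM_pow_smear, smear_apply]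
    refine integral_congr_ae (.of_forall fun x => ?_)
    simp only [derivCLM_pow_reflect]
    change χ x * ((-1) ^ (i : ℕ) * (derivCLM ^ (i : ℕ)) ρ (x - y)) =
      χ x * ((-1) ^ (i : ℕ) * (derivCLM ^ (i : ℕ)) ρ (0 - (y - x)))
    rw [zero_sub, neg_sub]
  have h₂ : (∫ x, c x).2 = ∫ x, χ x * U (reflect x ρ) :=
    ((ContinuousLinearMap.snd ℂ (Fin (k + 1) → BoundedContinuousFunction ℝ ℂ)
      ℂ).integral_comp_comm hci).symm
  have h := hP _ hint
  rw [h₁, h₂, sub_self, norm_zero, mul_zero] at h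
  exact sub_eq_zero.1 (norm_le_zero_iff.1 h)

/-! ### Mollifiers -/

/-- Smooth bumps shrinking to the origin. -/
def bump (n : ℕ) : ContDiffBump (0 : ℝ) where
  rIn := 1 / (n + 1) / 2
  rOut := 1 / (n + 1)
  rIn_pos := by positivity
  rIn_lt_rOut := half_lt_self (by positivity)

/-- An approximate identity. -/
def mollifier (n : ℕ) : TestFn where
  toFun x := ((bump n).normed volume x : ℂ)
  contDiff' := Complex.ofRealCLM.contDiff.comp (bump n).contDiff_normed
  hasCompactSupport' := (bump n).hasCompactSupport_normed.comp_left Complex.ofReal_zero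
  tsupport_subset' := Set.subset_univ _

theorem mollifier_apply (n : ℕ) (x : ℝ) : mollifier n x = ((bump n).normed volume x : ℂ) := rfl

theorem integral_mollifier (n : ℕ) : ∫ x, mollifier n x = 1 := by
  simp_rw [mollifier_apply]
  rw [integral_complex_ofReal, (bump n).integral_normed, Complex.ofReal_one]

theorem integral_norm_mollifier (n : ℕ) : ∫ x, ‖mollifier n x‖ = 1 := by
  simp_rw [mollifier_apply, Complex.norm_real, Real.norm_of_nonneg ((bump n).nonneg_normed _)]
  exact (bump n).integral_normed

theorem reflect_zero_mollifier (n : ℕ) : reflect 0 (mollifier n) = mollifier n := by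
  ext x
  rw [reflect_apply, zero_sub, mollifier_apply, mollifier_apply, (bump n).normed_neg]

theorem mollifier_eq_zero (n : ℕ) {x : ℝ} (hx : 1 ≤ |x|) : mollifier n x = 0 := by
  rw [mollifier_apply, Complex.ofReal_eq_zero, ← Function.notMem_support, (bump n).support_normed_eq,
    mem_ball_zero_iff, not_lt, Real.norm_eq_abs]
  refine le_trans ?_ hx
  change 1 / ((n : ℝ) + 1) ≤ 1
  exact (div_le_one (by positivity)).2 (by linarith [n.cast_nonneg (α := ℝ)])

/-- Dominated convergence: pointwise limits hold almost everywhere by Lebesgue differentiation, and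
all mollifiers live in `[-1, 1]`, so `2C` on a slightly larger ball dominates. Continuity of `u` is
not assumed because the primitive kernel jumps at `0`. -/
theorem tendsto_smear_mollifier {u : ℝ → ℂ} (hu : Integrable u) (hc : HasCompactSupport u) {C : ℝ}
    (hC : ∀ x, ‖u x‖ ≤ C) :
    Tendsto (fun n => ∫ x, ‖smear u hu hc (mollifier n) x - u x‖) atTop (𝓝 0) := by
  have hC₀ : 0 ≤ C := (norm_nonneg _).trans (hC 0)
  obtain ⟨R, hR⟩ := hc.isCompact.isBounded.subset_closedBall 0
  have hR' : ∀ x, R < |x| → u x = 0 := fun x hx => by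
    by_contra h
    have := hR (subset_tsupport _ h)
    rw [mem_closedBall_zero_iff, Real.norm_eq_abs] at this
    linarith
  have hb : ∀ n x, ‖smear u hu hc (mollifier n) x - u x‖ ≤
      (Metric.closedBall 0 (R + 1)).indicator (fun _ => C + C) x := by
    intro n x
    by_cases hx : x ∈ Metric.closedBall (0 : ℝ) (R + 1)
    · rw [Set.indicator_of_mem hx]
      refine (norm_sub_le _ _).trans (add_le_add ?_ (hC x))
      rw [smear_apply]
      have h₁ : ∀ t, ‖u t * mollifier n (x - t)‖ ≤ C * ‖reflect x (mollifier n) t‖ := fun t => by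
        rw [norm_mul]
        exact mul_le_mul_of_nonneg_right (hC t) (norm_nonneg _)
      refine (norm_integral_le_of_norm_le ((integrable _).norm.const_mul C)
        (.of_forall h₁)).trans (le_of_eq ?_)
      rw [integral_const_mul, integral_norm_reflect, integral_norm_mollifier, mul_one]
    · rw [Set.indicator_of_notMem hx]
      rw [mem_closedBall_zero_iff, Real.norm_eq_abs, not_le] at hx
      rw [hR' x (by linarith), sub_zero, smear_apply, integral_eq_zero_of_ae, norm_zero]
      refine .of_forall fun t => ?_
      rcases lt_or_ge R |t| with ht | ht
      · simp [hR' t ht]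
      · have : 1 ≤ |x - t| := by linarith [abs_sub_abs_le_abs_sub x t]
        simp [mollifier_eq_zero n this]
  have hlim : ∀ᵐ x, Tendsto (fun n => ‖smear u hu hc (mollifier n) x - u x‖) atTop (𝓝 0) := by
    have h := ContDiffBump.ae_convolution_tendsto_right_of_locallyIntegrable (μ := volume)
      (φ := bump) (l := atTop) (K := 2) tendsto_one_div_add_atTop_nhds_zero_nat
      (.of_forall fun n => (mul_div_cancel₀ _ two_ne_zero).ge) hu.locallyIntegrable
    filter_upwards [h] with x hx
    rw [← tendsto_iff_norm_sub_tendsto_zero]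
    refine hx.congr fun n => ?_
    rw [smear_apply, convolution_def, ← integral_sub_left_eq_self _ volume x]
    refine integral_congr_ae (.of_forall fun t => ?_)
    simp [mollifier_apply, mul_comm]
  have h := tendsto_integral_of_dominated_convergence
    ((Metric.closedBall 0 (R + 1)).indicator fun _ => C + C)
    (fun n => ((integrable _).sub hu).norm.aestronglyMeasurable)
    ((integrable_indicator_iff Metric.isClosed_closedBall.measurableSet).2
      (integrableOn_const (measure_closedBall_lt_top (μ := volume) (x := (0 : ℝ))).ne))
    (fun n => .of_forall fun x => by
      rw [norm_norm]
      exact hb n x) hlim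
  simpa using h

end TestFn

/-! ### Evaluation formulas for distributions. -/

open TestFn

theorem Distr.ofFun_apply {f : ℝ → ℂ} (hf : LocallyIntegrable f) (φ : TestFn) :
    Distr.ofFun f φ = ∫ x, φ x * f x :=
  TestFunction.integralAgainstBilinCLM_eq_integral (hf.locallyIntegrableOn _)

theorem Distr.deriv_apply (T : Distr) (φ : TestFn) : Distr.deriv T φ = -T (derivCLM φ) := rfl

theorem Distr.translate_apply (h : ℝ) (T : Distr) (φ : TestFn) :
    Distr.translate h T φ = T (shiftCLM h φ) := rfl

theorem Distr.sum_apply {ι : Type*} (s : Finset ι) (T : ι → Distr) (φ : TestFn) :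
    (∑ i ∈ s, T i) φ = ∑ i ∈ s, T i φ := by
  induction s using Finset.cons_induction with
  | empty => simp
  | cons a s h ih => rw [Finset.sum_cons, Finset.sum_cons, ← ih]; rfl

/-! ### From almost automorphic regularizations to sums of derivatives. -/

namespace TestFn

/-- The regularizations `U * φ` are almost automorphic. -/
def HasAlmostAutomorphicRegularizations (U : TestFn →ₗ[ℂ] ℂ) : Prop :=
  ∀ φ, IsAlmostAutomorphic fun x => U (reflect x φ)

/-- The linear form `U` is a finite sum of derivatives of almost automorphic functions. -/
def IsSumOfDerivatives (U : TestFn →ₗ[ℂ] ℂ) : Prop :=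
  ∃ (n : ℕ) (f : ℕ → ℝ → ℂ), (∀ j, IsAlmostAutomorphic (f j)) ∧
    ∀ φ, U φ = ∑ j ∈ Finset.range (n + 1), (Distr.deriv^[j] (Distr.ofFun (f j))) φ

variable {U : TestFn →ₗ[ℂ] ℂ}

theorem HasAlmostAutomorphicRegularizations.comp_smear (h : HasAlmostAutomorphicRegularizations U)
    {u : ℝ → ℂ} (hu : Integrable u) (hc : HasCompactSupport u) :
    HasAlmostAutomorphicRegularizations (U ∘ₗ smear u hu hc) := by
  intro φ
  simp only [LinearMap.comp_apply, smear_reflect]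
  exact h _

theorem HasAlmostAutomorphicRegularizations.neg (h : HasAlmostAutomorphicRegularizations U) :
    HasAlmostAutomorphicRegularizations (-U) :=
  fun φ => (h φ).neg

theorem HasOrder.comp_smear {k : ℕ} (hU : HasOrder U k) {u : ℝ → ℂ} (hu : Integrable u)
    (hc : HasCompactSupport u) : HasOrder (U ∘ₗ smear u hu hc) k := by
  obtain ⟨C, hC, h⟩ := hU
  refine ⟨C * ∫ x, ‖u x‖, by positivity, fun φ => (h _).trans ?_⟩
  rw [mul_assoc]
  exact mul_le_mul_of_nonneg_left (sobolev_smear_le k φ) hC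

theorem HasOrder.neg {k : ℕ} (hU : HasOrder U k) : HasOrder (-U) k := by
  obtain ⟨C, hC, h⟩ := hU
  refine ⟨C, hC, fun φ => ?_⟩
  rw [LinearMap.neg_apply, norm_neg]
  exact h φ

/-- Convolving a form of order zero with a bounded function gives an almost automorphic function. -/
theorem HasOrder.exists_ofFun_comp_smear (hU : HasOrder U 0)
    (hreg : HasAlmostAutomorphicRegularizations U) {u : ℝ → ℂ} (hu : Integrable u)
    (hc : HasCompactSupport u) {C : ℝ} (hC : ∀ x, ‖u x‖ ≤ C) :
    ∃ F, IsAlmostAutomorphic F ∧ ∀ φ, (U ∘ₗ smear u hu hc) φ = Distr.ofFun F φ := by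
  set V := U ∘ₗ smear u hu hc
  have hV : HasOrder V 0 := hU.comp_smear hu hc
  let w : ℝ → ℂ := fun t => u (-t)
  have hw : Integrable w := hu.comp_neg
  have hwc : HasCompactSupport w := hasCompactSupport_comp_neg hc
  let a : ℕ → ℝ := fun n => ∫ x, ‖smear w hw hwc (mollifier n) x - w x‖
  have ha : Tendsto a atTop (𝓝 0) := tendsto_smear_mollifier hw hwc fun x => hC (-x)
  let F : ℕ → ℝ → ℂ := fun n x => V (reflect x (mollifier n))
  have hF : ∀ n, IsAlmostAutomorphic (F n) := fun n => hreg.comp_smear hu hc (mollifier n)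
  obtain ⟨B, hB, hUB⟩ := hU
  -- Order zero means an `L¹` bound, which reflections preserve; the estimate is therefore uniform
  -- in `x`.
  have hdist : ∀ n m x, dist (F n x) (F m x) ≤ B * (a n + a m) := by
    intro n m x
    have h₁ : F n x - F m x =
        U (reflect x (smear w hw hwc (mollifier n) - smear w hw hwc (mollifier m))) := by
      simp only [F, V, LinearMap.comp_apply, smear_reflect, reflect_sub, map_sub, w]
    rw [dist_eq_norm, h₁]
    refine (hUB _).trans (mul_le_mul_of_nonneg_left ?_ hB)
    rw [sobolev_zero, integral_norm_reflect]
    have hi : ∀ n, Integrable fun x => ‖smear w hw hwc (mollifier n) x - w x‖ :=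
      fun n => ((TestFn.integrable _).sub hw).norm
    rw [← integral_add (hi n) (hi m)]
    refine integral_mono (TestFn.integrable _).norm ((hi n).add (hi m)) fun y => ?_
    have h := dist_triangle_right (smear w hw hwc (mollifier n) y)
      (smear w hw hwc (mollifier m) y) (w y)
    simp only [dist_eq_norm] at h
    exact h
  have hcau : UniformCauchySeqOn F atTop Set.univ := by
    refine Metric.uniformCauchySeqOn_iff.2 fun ε hε => ?_
    have h₂ : Tendsto (fun n => B * a n) atTop (𝓝 0) := by simpa using ha.const_mul B
    obtain ⟨N, hN⟩ := eventually_atTop.1 (h₂.eventually_lt_const (half_pos hε))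
    refine ⟨N, fun n hn m hm x _ => (hdist n m x).trans_lt ?_⟩
    have := hN n hn
    have := hN m hm
    linarith
  have hpt : ∀ x, ∃ y, Tendsto (fun n => F n x) atTop (𝓝 y) := fun x =>
    cauchySeq_tendsto_of_complete (hcau.cauchySeq (Set.mem_univ x))
  choose G hG using hpt
  have hunif : TendstoUniformly F G atTop :=
    tendstoUniformlyOn_univ.1 (hcau.tendstoUniformlyOn_of_tendsto fun x _ => hG x)
  have hGa : IsAlmostAutomorphic G := .of_tendstoUniformly hF hunif
  refine ⟨G, hGa, fun φ => ?_⟩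
  rw [Distr.ofFun_apply hGa.1.locallyIntegrable]
  obtain ⟨M, hM⟩ := hGa.bounded
  have hlim₁ : Tendsto (fun n => ∫ x, φ x * F n x) atTop (𝓝 (∫ x, φ x * G x)) := by
    refine tendsto_integral_filter_of_dominated_convergence (fun x => ‖φ x‖ * (M + 1))
      (.of_forall fun n => (φ.continuous.mul (hF n).1).aestronglyMeasurable) ?_
      (φ.integrable.norm.mul_const _) (.of_forall fun x => (hG x).const_mul _)
    filter_upwards [Metric.tendstoUniformly_iff.1 hunif 1 one_pos] with n hn
    refine .of_forall fun x => ?_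
    rw [norm_mul]
    refine mul_le_mul_of_nonneg_left ?_ (norm_nonneg _)
    have h := norm_le_norm_add_norm_sub' (F n x) (G x)
    have h' := hn x
    rw [dist_eq_norm, norm_sub_rev] at h'
    linarith [hM x]
  -- The same integrals equal `V (φ ⋆ mollifier n)`, which tends to `V φ` because `V` is
  -- `L¹`-bounded.
  refine tendsto_nhds_unique ?_ hlim₁
  simp_rw [F, hV.integral_mul_reflect, reflect_zero_mollifier]
  obtain ⟨D, hD, hVD⟩ := hV
  rw [tendsto_iff_norm_sub_tendsto_zero]
  have hlim₂ := (tendsto_smear_mollifier φ.integrable φ.hasCompactSupport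
    (toBCF φ).norm_coe_le_norm).const_mul D
  rw [mul_zero] at hlim₂
  refine squeeze_zero (fun _ => norm_nonneg _) (fun n => ?_) hlim₂
  rw [← map_sub]
  refine (hVD _).trans (le_of_eq ?_)
  rw [sobolev_zero]
  rfl


/-- One order is gained since `(P φ)' = φ - η ⋆ φ` contains no derivative of `φ`. This part costs `1
+ ‖η‖₁`, and the undifferentiated term costs the `L¹` norm of the kernel. -/
theorem HasOrder.comp_primitive {k : ℕ} (hU : HasOrder U (k + 1)) {η : TestFn}
    (hη : ∫ t, η t = 1) : HasOrder (U ∘ₗ primitive hη) k := by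
  obtain ⟨C, hC, h⟩ := hU
  refine ⟨C * (1 + (∫ t, ‖η t‖) + ∫ t, ‖primitiveKernel η t‖), by positivity,
    fun φ => (h _).trans ?_⟩
  rw [mul_assoc]
  refine mul_le_mul_of_nonneg_left ?_ hC
  have h₀ : derivCLM (primitive hη φ) = primitive hη (derivCLM φ) := derivCLM_smear φ
  rw [sobolev_succ, h₀, primitive_derivCLM, add_mul, add_mul, one_mul]
  refine add_le_add ((sobolev_sub_le _ _ _).trans
    (add_le_add_right (sobolev_smear_le k φ) _)) ?_
  refine (integral_norm_smear_le φ).trans ?_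
  rw [← sobolev_zero φ]
  exact mul_le_mul_of_nonneg_left (sobolev_mono (Nat.zero_le k) φ) (by positivity)

/-- A form of finite order is, up to an almost automorphic function, a derivative. -/
theorem HasOrder.apply_eq {k : ℕ} (hU : HasOrder U k)
    (hreg : HasAlmostAutomorphicRegularizations U) {η : TestFn} (hη : ∫ t, η t = 1) :
    ∃ F, IsAlmostAutomorphic F ∧
      ∀ φ, U φ = Distr.ofFun F φ - (-(U ∘ₗ primitive hη)) (derivCLM φ) := by
  -- The regularization by the reflected `η`: `HasOrder.integral_mul_reflect` reflects once more,
  -- leaving `U (φ ⋆ η)`.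
  refine ⟨_, hreg (reflect 0 η), fun φ => ?_⟩
  have h₁ : reflect 0 (reflect 0 η) = η := by
    ext x
    simp
  rw [Distr.ofFun_apply (hreg (reflect 0 η)).1.locallyIntegrable, hU.integral_mul_reflect, h₁,
    LinearMap.neg_apply, LinearMap.comp_apply, primitive_derivCLM, map_sub, smear_comm]
  ring

/-- The hypothesis says `U = F + V'`: `F` takes index `0` and the functions of `V` move up by one.
-/
theorem IsSumOfDerivatives.of_deriv {V : TestFn →ₗ[ℂ] ℂ} (hV : IsSumOfDerivatives V) {F : ℝ → ℂ}
    (hF : IsAlmostAutomorphic F) (h : ∀ φ, U φ = Distr.ofFun F φ - V (derivCLM φ)) :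
    IsSumOfDerivatives U := by
  obtain ⟨n, f, hf, hVf⟩ := hV
  refine ⟨n + 1, fun j => Nat.casesOn j F f, fun j => by cases j <;> simp [hF, hf], fun φ => ?_⟩
  rw [Finset.sum_range_succ', h φ, hVf]
  simp only [Function.iterate_succ_apply', Distr.deriv_apply, Finset.sum_neg_distrib]
  exact sub_eq_neg_add _ _

theorem HasOrder.isSumOfDerivatives {k : ℕ} (hU : HasOrder U k)
    (hreg : HasAlmostAutomorphicRegularizations U) : IsSumOfDerivatives U := by
  have hη := integral_mollifier 0
  induction k generalizing U with
  | zero =>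
    obtain ⟨F, hF, h⟩ := hU.apply_eq hreg hη
    obtain ⟨G, hG, hV⟩ := hU.neg.exists_ofFun_comp_smear hreg.neg (integrable_primitiveKernel hη)
      (hasCompactSupport_primitiveKernel hη) (norm_primitiveKernel_le _)
    exact .of_deriv ⟨0, fun _ => G, fun _ => hG, fun φ => (hV φ).trans (by simp)⟩ hF h
  | succ k ih =>
    obtain ⟨F, hF, h⟩ := hU.apply_eq hreg hη
    exact .of_deriv (ih (hU.comp_primitive hη).neg (hreg.comp_smear _ _).neg) hF h

end TestFn

/-! ### Bounded distributions -/

/-- The linear form underlying a distribution. -/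
def Distr.toLinearMap (T : Distr) : TestFn →ₗ[ℂ] ℂ where
  toFun := T
  map_add' φ ψ := map_add T φ ψ
  map_smul' c φ := map_smul T c φ

theorem seminorm_toDL1 (m : ℕ) (φ : TestFn) : DL1.seminorm m φ.toDL1 = sobolev m φ := by
  change ∑ i ∈ Finset.range (m + 1), ∫ x, ‖iteratedDeriv i φ x‖ = _
  simp_rw [iteratedDeriv_eq]
  rfl

/-- Continuity gives a bound by finitely many norms; they increase with the index, so the largest
one suffices. -/
theorem Distr.IsBounded.exists_hasOrder {T : Distr} (hT : T.IsBounded) :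
    ∃ k, HasOrder T.toLinearMap k := by
  obtain ⟨L, hL⟩ := hT
  let q : Seminorm ℂ DL1 := (normSeminorm ℂ ℂ).comp L.toLinearMap
  obtain ⟨s, C, -, h⟩ := Seminorm.bound_of_continuous DL1.withSeminorms q
    (continuous_norm.comp L.continuous)
  refine ⟨s.sup id, C, C.2, fun φ => ?_⟩
  have h₁ : ‖T φ‖ ≤ C * (s.sup DL1.seminorm) φ.toDL1 := by
    rw [hL φ]
    exact h φ.toDL1
  refine h₁.trans (mul_le_mul_of_nonneg_left ?_ C.2)
  refine Seminorm.finset_sup_apply_le (sobolev_nonneg _ _) fun m hm => ?_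
  rw [seminorm_toDL1]
  exact sobolev_mono (Finset.le_sup (f := id) hm) φ

/-! ### Convergence of distributions -/

namespace TestFn

theorem memLp_one (φ : TestFn) : MemLp φ 1 := memLp_one_iff_integrable.2 φ.integrable

/-- Test functions as elements of `L¹`. -/
def toL1 : TestFn →ₗ[ℂ] Lp ℂ 1 (volume : Measure ℝ) where
  toFun φ := φ.memLp_one.toLp
  map_add' φ ψ := MemLp.toLp_add φ.memLp_one ψ.memLp_one
  map_smul' c φ := MemLp.toLp_const_smul c φ.memLp_one

theorem norm_toL1 (φ : TestFn) : ‖toL1 φ‖ = ∫ x, ‖φ x‖ := by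
  rw [L1.norm_eq_integral_norm]
  refine integral_congr_ae ?_
  filter_upwards [φ.memLp_one.coeFn_toLp] with x hx
  exact congrArg _ hx

/-- For the LF topology it suffices to test on each compact support, where the sup norm controls the
`L¹` norm. -/
theorem continuous_toL1 : Continuous toL1 := by
  rw [TestFunction.continuous_iff_continuous_comp]
  intro K hK
  obtain ⟨R, hR⟩ := K.isCompact.isBounded.subset_closedBall 0
  rw [Real.closedBall_eq_Icc, zero_sub, zero_add] at hR
  have hK' : ∀ f, TestFunction.ofSupportedIn hK f ∈ supportedIn (max R 0) := fun f y hy =>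
    f.zero_on_compl fun hy' => hy ⟨(neg_le_neg (le_max_left _ _)).trans (hR hy').1,
      (hR hy').2.trans (le_max_left _ _)⟩
  refine continuous_iff_continuousAt.2 fun f => tendsto_iff_norm_sub_tendsto_zero.2 ?_
  have h : Tendsto (fun g => 2 * max R 0 * ‖toBCF (TestFunction.ofSupportedIn hK g) -
      toBCF (TestFunction.ofSupportedIn hK f)‖) (𝓝 f) (𝓝 0) := by
    have := (tendsto_iff_norm_sub_tendsto_zero.1 ((toBCF.continuous.comp
      (TestFunction.continuous_ofSupportedIn hK)).tendsto f)).const_mul (2 * max R 0)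
    rwa [mul_zero] at this
  refine squeeze_zero (fun _ => norm_nonneg _) (fun g => ?_) h
  rw [Function.comp_apply, Function.comp_apply, ← map_sub, ← map_sub, norm_toL1]
  exact integral_norm_le (le_max_right _ _) (Submodule.sub_mem _ (hK' g) (hK' f))

end TestFn

theorem locallyIntegrable_of_norm_le {f : ℝ → ℂ} (hf : AEStronglyMeasurable f) {M : ℝ}
    (hM : ∀ x, ‖f x‖ ≤ M) : LocallyIntegrable f :=
  (memLp_top_of_bound hf M (.of_forall hM)).locallyIntegrable le_top

/-- Dominated convergence gives the limit on each test function. The common bound `M * ‖toL1 φ‖`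
makes the family equicontinuous, which upgrades this to uniform convergence on compact sets. -/
theorem Distr.tendsto_ofFun {f : ℕ → ℝ → ℂ} {g : ℝ → ℂ} (hf : ∀ n, AEStronglyMeasurable (f n))
    {M : ℝ} (hM : ∀ n x, ‖f n x‖ ≤ M) (h : ∀ x, Tendsto (fun n => f n x) atTop (𝓝 (g x))) :
    Tendsto (fun n => Distr.ofFun (f n)) atTop (𝓝 (Distr.ofFun g)) := by
  have hg : LocallyIntegrable g := locallyIntegrable_of_norm_le
    (aestronglyMeasurable_of_tendsto_ae atTop hf (.of_forall h))
    fun x => le_of_tendsto (h x).norm (.of_forall fun n => hM n x)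
  have hfl : ∀ n, LocallyIntegrable (f n) := fun n => locallyIntegrable_of_norm_le (hf n) (hM n)
  have hbound : ∀ n φ, ‖Distr.ofFun (f n) φ‖ ≤ M * ‖toL1 φ‖ := by
    intro n φ
    rw [Distr.ofFun_apply (hfl n), norm_toL1, ← integral_const_mul]
    refine norm_integral_le_of_norm_le (φ.integrable.norm.const_mul M) (.of_forall fun x => ?_)
    rw [norm_mul, mul_comm]
    exact mul_le_mul_of_nonneg_right (hM n x) (norm_nonneg _)
  have hequi : Equicontinuous fun n φ => Distr.ofFun (f n) φ := by
    intro φ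
    refine Metric.equicontinuousAt_of_continuity_modulus (fun ψ => M * ‖toL1 φ - toL1 ψ‖) ?_ _
      (.of_forall fun ψ n => ?_)
    · have : Continuous fun ψ => M * ‖toL1 φ - toL1 ψ‖ :=
        continuous_const.mul (continuous_const.sub continuous_toL1).norm
      simpa using this.tendsto φ
    · rw [dist_eq_norm, ← map_sub, ← map_sub]
      exact hbound n _
  rw [(UniformConvergenceCLM.isEmbedding_coeFn (RingHom.id ℂ) ℂ
    {S : Set TestFn | IsCompact S}).tendsto_nhds_iff]
  refine (EquicontinuousOn.tendsto_uniformOnFun_iff_pi (fun K hK => hK) Set.sUnion_isCompact_eq_univ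
    (fun K _ => hequi.equicontinuousOn K) _ _).2 (tendsto_pi_nhds.2 fun φ => ?_)
  simp only [Distr.ofFun_apply (hfl _), Distr.ofFun_apply hg]
  refine tendsto_integral_of_dominated_convergence (fun x => ‖φ x‖ * M)
    (fun n => φ.continuous.aestronglyMeasurable.mul (hf n)) (φ.integrable.norm.mul_const M)
    (fun n => .of_forall fun x => ?_) (.of_forall fun x => (h x).const_mul _)
  rw [norm_mul]
  exact mul_le_mul_of_nonneg_left (hM n x) (norm_nonneg _)

/-! ### Translates of sums of derivatives. -/

theorem Distr.continuous_deriv : Continuous Distr.deriv :=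
  ((derivCLM.precompCompactConvergenceCLM ℂ).continuous).neg

theorem Distr.translate_deriv (h : ℝ) (T : Distr) :
    Distr.translate h (Distr.deriv T) = Distr.deriv (Distr.translate h T) := by
  ext φ
  rw [Distr.translate_apply, Distr.deriv_apply, Distr.deriv_apply, Distr.translate_apply,
    derivCLM_shiftCLM]

theorem Distr.translate_ofFun (h : ℝ) {f : ℝ → ℂ} (hf : AEStronglyMeasurable f) {M : ℝ}
    (hM : ∀ x, ‖f x‖ ≤ M) :
    Distr.translate h (Distr.ofFun f) = Distr.ofFun fun x => f (x + h) := by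
  ext φ
  have hf' : AEStronglyMeasurable fun x => f (x + h) :=
    hf.comp_measurePreserving (measurePreserving_add_right volume h)
  rw [Distr.translate_apply, Distr.ofFun_apply (locallyIntegrable_of_norm_le hf hM),
    Distr.ofFun_apply (locallyIntegrable_of_norm_le hf' fun x => hM _),
    ← integral_add_right_eq_self _ h]
  simp

theorem Distr.translate_sum_deriv_ofFun (h : ℝ) (n : ℕ) {f : ℕ → ℝ → ℂ}
    (hf : ∀ j, AEStronglyMeasurable (f j)) {M : ℕ → ℝ} (hM : ∀ j x, ‖f j x‖ ≤ M j) :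
    Distr.translate h (∑ j ∈ Finset.range n, Distr.deriv^[j] (Distr.ofFun (f j))) =
      ∑ j ∈ Finset.range n, Distr.deriv^[j] (Distr.ofFun fun x => f j (x + h)) := by
  rw [Distr.translate, map_sum]
  refine Finset.sum_congr rfl fun j _ => ?_
  rw [← Distr.translate_ofFun h (hf j) (hM j)]
  exact Function.Semiconj.iterate_right (Distr.translate_deriv h) j _

/-- The translates of a sum of derivatives converge together with those of the functions. -/
theorem Distr.tendsto_translate_sum_deriv_ofFun (n : ℕ) {f g : ℕ → ℝ → ℂ} {s : ℕ → ℝ}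
    (hf : ∀ j, AEStronglyMeasurable (f j)) {M : ℕ → ℝ} (hM : ∀ j x, ‖f j x‖ ≤ M j)
    (h : ∀ j x, Tendsto (fun k => f j (x + s k)) atTop (𝓝 (g j x))) :
    Tendsto (fun k => Distr.translate (s k)
      (∑ j ∈ Finset.range n, Distr.deriv^[j] (Distr.ofFun (f j)))) atTop
      (𝓝 (∑ j ∈ Finset.range n, Distr.deriv^[j] (Distr.ofFun (g j)))) := by
  simp_rw [Distr.translate_sum_deriv_ofFun _ n hf hM]
  refine tendsto_finsetSum _ fun j _ => ?_
  refine ((Distr.continuous_deriv.iterate j).tendsto _).comp (Distr.tendsto_ofFun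
    (fun k => (hf j).comp_measurePreserving (measurePreserving_add_right volume (s k)))
    (fun k x => hM j _) (h j))

/-- The limits `g j` may be discontinuous, but they are measurable and inherit the bounds of `f j`;
that is enough to translate back. -/
theorem Distr.exists_subseq_tendsto_translate (n : ℕ) {f : ℕ → ℝ → ℂ}
    (hf : ∀ j, IsAlmostAutomorphic (f j)) (s : ℕ → ℝ) :
    ∃ m : ℕ → ℕ, StrictMono m ∧ ∃ S : Distr,
      Tendsto (fun k => Distr.translate (s (m k))
        (∑ j ∈ Finset.range n, Distr.deriv^[j] (Distr.ofFun (f j)))) atTop (𝓝 S) ∧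
      Tendsto (fun k => Distr.translate (-s (m k)) S) atTop
        (𝓝 (∑ j ∈ Finset.range n, Distr.deriv^[j] (Distr.ofFun (f j)))) := by
  obtain ⟨m, hm, g, hg⟩ := IsAlmostAutomorphic.exists_common_subseq hf s
  choose M hM using fun j => (hf j).bounded
  have hfm : ∀ j, AEStronglyMeasurable (f j) := fun j => (hf j).1.aestronglyMeasurable
  have hgm : ∀ j, AEStronglyMeasurable (g j) := fun j =>
    aestronglyMeasurable_of_tendsto_ae atTop (fun k => (hfm j).comp_measurePreserving
      (measurePreserving_add_right volume (s (m k)))) (.of_forall (hg j).1)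
  refine ⟨m, hm, _, Distr.tendsto_translate_sum_deriv_ofFun n hfm hM fun j => (hg j).1,
    Distr.tendsto_translate_sum_deriv_ofFun n hgm (M := M)
      (fun j x => le_of_tendsto ((hg j).1 x).norm (.of_forall fun k => hM j _))
      fun j x => ?_⟩
  simpa only [sub_eq_add_neg] using (hg j).2 x

/-- Evaluation at `reflect x φ` is continuous on distributions, and translation by `h` turns it into
evaluation at `reflect (x + h) φ`. Finite order serves only for the continuity of `T * φ`. -/
theorem Distr.conv_isAlmostAutomorphic {T : Distr} {k : ℕ} (hT : HasOrder T.toLinearMap k)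
    (h : ∀ s : ℕ → ℝ, ∃ m : ℕ → ℕ, StrictMono m ∧ ∃ S : Distr,
      Tendsto (fun k => Distr.translate (s (m k)) T) atTop (𝓝 S) ∧
      Tendsto (fun k => Distr.translate (-s (m k)) S) atTop (𝓝 T)) (φ : TestFn) :
    IsAlmostAutomorphic (Distr.conv T φ) := by
  refine ⟨hT.continuous_reflect φ, fun s => ?_⟩
  obtain ⟨m, hm, S, h₁, h₂⟩ := h s
  refine ⟨m, hm, Distr.conv S φ, fun x => ?_, fun x => ?_⟩
  · have := ((continuous_eval_const (F := Distr) (reflect x φ)).tendsto _).comp h₁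
    refine this.congr fun k => ?_
    rw [Function.comp_apply, Distr.translate_apply, shiftCLM_reflect]
    rfl
  · have := ((continuous_eval_const (F := Distr) (reflect x φ)).tendsto _).comp h₂
    refine this.congr fun k => ?_
    rw [Function.comp_apply, Distr.translate_apply, shiftCLM_reflect, ← sub_eq_add_neg]
    rfl

end AlmostAutomorphic

end

/-! ### The equivalence. -/

theorem mainTheorem1 (T : AlmostAutomorphic.Distr) (hT : T.IsBounded) :
    List.TFAE [
      ∃ (n : ℕ) (f : ℕ → ℝ → ℂ), (∀ j ≤ n, AlmostAutomorphic.IsAlmostAutomorphic (f j)) ∧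
        T = ∑ j ∈ Finset.range (n + 1),
          AlmostAutomorphic.Distr.deriv^[j] (AlmostAutomorphic.Distr.ofFun (f j)),
      ∀ s : ℕ → ℝ, ∃ m : ℕ → ℕ, StrictMono m ∧ ∃ S : AlmostAutomorphic.Distr,
        Tendsto (fun k => AlmostAutomorphic.Distr.translate (s (m k)) T) atTop (𝓝 S) ∧
        Tendsto (fun k => AlmostAutomorphic.Distr.translate (-s (m k)) S) atTop (𝓝 T),
      ∀ φ : AlmostAutomorphic.TestFn,
        AlmostAutomorphic.IsAlmostAutomorphic (AlmostAutomorphic.Distr.conv T φ)] := by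
  obtain ⟨k, hk⟩ := hT.exists_hasOrder
  tfae_have 1 → 2 := by
    rintro ⟨n, f, hf, rfl⟩ s
    -- Beyond `n` nothing is known about `f j`; zero replaces it so that the diagonal lemma applies
    -- to the whole sequence.
    let F : ℕ → ℝ → ℂ := fun j => if j ≤ n then f j else fun _ => 0
    have hF : ∀ j, AlmostAutomorphic.IsAlmostAutomorphic (F j) := by
      intro j
      by_cases hj : j ≤ n
      · simpa only [F, if_pos hj] using hf j hj
      · simpa only [F, if_neg hj] using AlmostAutomorphic.IsAlmostAutomorphic.zero
    have hsum : ∑ j ∈ Finset.range (n + 1),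
        AlmostAutomorphic.Distr.deriv^[j] (AlmostAutomorphic.Distr.ofFun (f j)) =
        ∑ j ∈ Finset.range (n + 1),
          AlmostAutomorphic.Distr.deriv^[j] (AlmostAutomorphic.Distr.ofFun (F j)) :=
      Finset.sum_congr rfl fun j hj => by
        simp only [F, if_pos (Nat.lt_succ_iff.1 (Finset.mem_range.1 hj))]
    rw [hsum]
    exact AlmostAutomorphic.Distr.exists_subseq_tendsto_translate (n + 1) hF s
  tfae_have 2 → 3 := AlmostAutomorphic.Distr.conv_isAlmostAutomorphic hk
  tfae_have 3 → 1 := by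
    intro h
    obtain ⟨n, f, hf, hTf⟩ := hk.isSumOfDerivatives h
    refine ⟨n, f, fun j _ => hf j, ?_⟩
    ext φ
    rw [AlmostAutomorphic.Distr.sum_apply]
    exact hTf φ
  tfae_finish
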